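/- Let $d,k\ge 1$ be integers and let $c_0,c_1>0$ be real constants. There is a constant $C'>0$, depending only on $d,k,c_0,c_1$, such that the following holds for all $n\ge1$, $g\ge 0$, $\beta\ge 0$ with $8gk\beta\le 1$, and $0<\epsilon\le 1$. Let $H=\sum_X h_X$ be a Hamiltonian on a chain of $n$ qudits of dimension $d$, where $X$ runs over the non-empty sets of sites with $\mathrm{diam}(X)=1+\max_{i,j\in X}|i-j|\le k$, each $h_X$ is Hermitian and acts on $X$, and $\sum_{X\ni i}\|h_X\|\le g$ for every site $i$ (operator norm). Put $$\ell_0=\lceil c_0k\log(6n/\epsilon)\rceil,\qquad m=\lceil c_1\log(6n/\epsilon)\rceil ,$$ divide the chain into $n_0=\lceil n/\ell_0\rceil$ consecutive blocks $B_1,\dots,B_{n_0}$ of $\ell_0$ sites (the last one possibly shorter), let $B_{n_0+1}=\emptyset$, $H_0=0$ and $$H_j=\sum_{X\subseteq B_j}h_X+\sum_{X\cap B_j\ne\emptyset,\ X\cap B_{j+1}\ne\emptyset}h_X\qquad(1\le j\le n_0),$$ let $T_m(x)=\sum_{s=0}^m x^s/s!$, and define the high-temperature approximation of $e^{-\beta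 H}$ as the product, ordered from left to right, $$M_\beta=\prod_{j=1}^{n_0}T_m(\beta H_{j-1})\,T_m\bigl(-\beta(H_{j-1}+H_j)\bigr).$$ For an operator $O$ and a site $i$ let $\mathrm{SR}(O,i)$ be the least $D$ such that $O=\sum_{a=1}^{D}P_a\otimes Q_a$ with $P_a$ acting on the sites $\le i$ and $Q_a$ on the sites $>i$. Then for every $q\in\mathbb N$ with $mq\neq 1$ and every site $i$, $$\log \mathrm{SR}(M_\beta^q,i)\le C'\max\bigl(q,\sqrt{mq}\bigr)\log(mq)$$ (for $q=0$, and if $M_\beta^q=0$, the inequality is read with $0\cdot\log 0=0$ and $\log 0=0$, respectively). -/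

import Mathlib

namespace SpinChain

/-- Operators on a chain of `n` qudits of local dimension `d`, i.e. on `(ℂ^d)^{⊗ n}`, written as
matrices in the product basis, which is labelled by the configurations `Fin n → Fin d`. -/
abbrev Operator (n d : ℕ) : Type :=
  Matrix (Fin n → Fin d) (Fin n → Fin d) ℂ

/-- The operator norm for the Euclidean norm on `(ℂ^d)^{⊗ n}`. -/
noncomputable def opNorm {n d : ℕ} (A : Operator n d) : ℝ :=
  ‖Matrix.toEuclideanCLM (𝕜 := ℂ) A‖

/-- `A` acts on the sites in `X` only: `A = B ⊗ 1`, where `B` is an operator on the qudits in `X`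
and `1` is the identity on the other qudits. -/
def ActsOn {n d : ℕ} (X : Finset (Fin n)) (A : Operator n d) : Prop :=
  ∃ B : Matrix (X → Fin d) (X → Fin d) ℂ, ∀ s t : Fin n → Fin d,
    A s t = if ∀ i, i ∉ X → s i = t i then B (fun i => s i) (fun i => t i) else 0

/-- `A = ∑_{a < D} P_a ⊗ Q_a`, with `P_a` acting on the sites `≤ i` and `Q_a` on the sites `> i`. -/
def HasSchmidtDecomposition {n d : ℕ} (A : Operator n d) (i : Fin n) (D : ℕ) : Prop :=
  ∃ P Q : Fin D → Operator n d,
    (∀ a, ActsOn (Finset.Iic i) (P a)) ∧ (∀ a, ActsOn (Finset.Ioi i) (Q a)) ∧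
      A = ∑ a, P a * Q a

/-- The Schmidt rank of `A` across the cut between the sites `≤ i` and the sites `> i`: the minimal
number of terms in a decomposition into products. -/
noncomputable def schmidtRank {n d : ℕ} (A : Operator n d) (i : Fin n) : ℕ :=
  sInf {D : ℕ | HasSchmidtDecomposition A i D}

/-- The minimum in the definition of the Schmidt rank is over a non-empty set. -/
theorem exists_hasSchmidtDecomposition {n d : ℕ} (A : Operator n d) (i : Fin n) :
    ∃ D : ℕ, HasSchmidtDecomposition A i D := by
  classical
  let E : Finset (Fin n) → (Fin n → Fin d) → (Fin n → Fin d) → Operator n d := fun X x y =>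
    Matrix.of fun s t => if ∀ j, j ∉ X → s j = t j then
      (if ∀ j : X, s j = x j ∧ t j = y j then 1 else 0) else 0
  have hE : ∀ X x y s t, E X x y s t = if ∀ j, j ∉ X → s j = t j then
      (if ∀ j : X, s j = x j ∧ t j = y j then 1 else 0) else 0 := fun X x y s t => rfl
  have hE' : ∀ X x y (c : ℂ), ActsOn X (c • E X x y) := fun X x y c =>
    ⟨Matrix.of fun s t => c * if ∀ j : X, s j = x j ∧ t j = y j then 1 else 0, fun s t => by
      rw [Matrix.smul_apply, hE, Matrix.of_apply, smul_eq_mul, mul_ite, mul_zero]⟩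
  have key : ∀ s t x y : Fin n → Fin d,
      (E (Finset.Iic i) s t * E (Finset.Ioi i) s t) x y = if s = x ∧ t = y then 1 else 0 := by
    intro s t x y
    rw [Matrix.mul_apply, Finset.sum_eq_single (fun j => if j ≤ i then t j else s j)]
    · simp only [hE, ← ite_and, ite_mul, one_mul, zero_mul]
      congr 1
      simp only [Finset.mem_Iic, Finset.mem_Ioi, Subtype.forall, eq_iff_iff, funext_iff]
      grind
    · intro z _ hz
      simp only [hE, ← ite_and, ite_mul, one_mul, zero_mul]
      rw [ite_eq_right_iff]
      intro h
      exfalso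
      apply hz
      funext j
      simp only [Finset.mem_Iic, Finset.mem_Ioi, Subtype.forall] at h
      grind
    · simp
  let e := Fintype.equivFin ((Fin n → Fin d) × (Fin n → Fin d))
  refine ⟨_, fun a => A (e.symm a).1 (e.symm a).2 • E (Finset.Iic i) (e.symm a).1 (e.symm a).2,
    fun a => (1 : ℂ) • E (Finset.Ioi i) (e.symm a).1 (e.symm a).2, fun a => hE' _ _ _ _,
    fun a => hE' _ _ _ _, ?_⟩
  rw [e.symm.sum_comp (fun p => (A p.1 p.2 • E (Finset.Iic i) p.1 p.2) *
    ((1 : ℂ) • E (Finset.Ioi i) p.1 p.2)), Fintype.sum_prod_type]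
  ext x y
  simp [Matrix.sum_apply, key, ite_and]

/-- A `k`-local Hamiltonian `H = ∑_X h_X` on the chain: `X` runs over the non-empty sets of sites
with `diam X = 1 + max_{i, j ∈ X} |i - j| ≤ k`, the operator `h_X` is Hermitian and acts on `X`, and
`∑_{X ∋ i} ‖h_X‖ ≤ g` for every site `i`. -/
structure LocalHamiltonian (n d k : ℕ) (g : ℝ) where
  term : Finset (Fin n) → Operator n d
  actsOn : ∀ X, ActsOn X (term X)
  isHermitian : ∀ X, (term X).IsHermitian
  term_empty : term ∅ = 0
  range : ∀ X, term X ≠ 0 → ∀ i ∈ X, ∀ j ∈ X, (i : ℕ) + 1 ≤ j + k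
  strength : ∀ i, ∑ X with i ∈ X, opNorm (term X) ≤ g

/-- The block `B_j = {(j - 1) ℓ, …, j ℓ - 1}` of `ℓ` consecutive sites, for `j = 1, 2, …`
(the sites are numbered from `0`, and the last block may be cut off by the end of the chain);
`B_0` is empty. -/
def block (n ℓ j : ℕ) : Finset (Fin n) :=
  {i : Fin n | j * ℓ ≤ i + ℓ ∧ (i : ℕ) < j * ℓ}

/-- The number `⌈n / ℓ⌉` of blocks. -/
noncomputable def numBlocks (n ℓ : ℕ) : ℕ := ⌈(n : ℝ) / ℓ⌉₊

/-- `H_j`: the interactions inside the block `B_j` and those between `B_j` and `B_{j+1}`. -/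
noncomputable def blockHamiltonian {n d k : ℕ} {g : ℝ} (H : LocalHamiltonian n d k g) (ℓ j : ℕ) :
    Operator n d :=
  ∑ X with X ⊆ block n ℓ j, H.term X +
    ∑ X with (X ∩ block n ℓ j).Nonempty ∧ (X ∩ block n ℓ (j + 1)).Nonempty, H.term X

/-- The truncated Taylor expansion `T_m(A) = ∑_{s ≤ m} A^s / s!` of the exponential. -/
noncomputable def taylorExp {n d : ℕ} (m : ℕ) (A : Operator n d) : Operator n d :=
  ∑ s ∈ Finset.range (m + 1), ((s.factorial : ℂ))⁻¹ • A ^ s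

/-- `T_m(β H_{j-1}) T_m(-β (H_{j-1} + H_j))` with `j = a + 1`; note that `H_0 = 0`. -/
noncomputable def localFactor {n d k : ℕ} {g : ℝ} (H : LocalHamiltonian n d k g) (β : ℝ)
    (ℓ m a : ℕ) : Operator n d :=
  taylorExp m ((β : ℂ) • blockHamiltonian H ℓ a) *
    taylorExp m (-(β : ℂ) • (blockHamiltonian H ℓ a + blockHamiltonian H ℓ (a + 1)))

/-- The high-temperature approximation `M_β` of `e^{-β H}` with block length `ℓ` and Taylor degree
`m`: the product of the local factors for `j = 1, …, ⌈n / ℓ⌉`, from left to right, that is,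
`T_m(-β H_1) T_m(β H_1) T_m(-β (H_1 + H_2)) T_m(β H_2) T_m(-β (H_2 + H_3)) ⋯`. -/
noncomputable def gibbsMPO {n d k : ℕ} {g : ℝ} (H : LocalHamiltonian n d k g) (β : ℝ)
    (ℓ m : ℕ) : Operator n d :=
  ((List.range (numBlocks n ℓ)).map (localFactor H β ℓ m)).prod

/-- The block length `ℓ₀ = c₀ k log (6 n / ε)`, rounded up. -/
noncomputable def blockLength (c₀ : ℝ) (k n : ℕ) (ε : ℝ) : ℕ :=
  ⌈c₀ * k * Real.log (6 * n / ε)⌉₊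

/-- The Taylor degree `m = c₁ log (6 n / ε)`, rounded up. -/
noncomputable def taylorDegree (c₁ : ℝ) (n : ℕ) (ε : ℝ) : ℕ :=
  ⌈c₁ * Real.log (6 * n / ε)⌉₊

end SpinChain

/-! Expanding every Taylor factor at the single cut at `i` would allow up to `m` crossings per
factor, hence a rank exponent of order `mq`. The saving comes from moving the cut. Take `r` cuts at
spacing `k`, starting at `i`. An interaction of diameter at most `k` crosses at most one of them. As
`r ≤ m` and `mk ≤ K ℓ₀` with `K` depending only on `c₀, c₁`, the strip they span meets boundedly
many blocks, so all but `P = 6K + 6` Taylor factors of each copy of `M_β` act wholly to the left or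
wholly to the right of the strip (`exists_gibbsMPO_eq`). A word in the expansion of `M_β ^ q` thus
has at most `Pmq` crossing letters, and by pigeonhole it crosses some cut at most `B = ⌊Pmq / r⌋`
times.

The crossings are counted by formal variables, one for each cut, in a monoid algebra over the
operators. The words are sorted by the first cut crossed at most `B` times, a condition that ignores
all later cuts (`augmentation_mem_sum`). At a fixed cut, all interactions to its right add up to one
operator `ρ`, so a Taylor factor with `b` crossings contributes on the right only products `ρ^a₀ Q
ρ^a₁ ⋯ Q ρ^a_b`. They span a space of dimension at most `(m + 1) (d^(2k) (m + 1))^b`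
(`gradedBound_expTrunc`). Bringing the cut back to `i` costs a factor `d^(2rk)`
(`schmidtRank_pow_le`).

For fixed `d, k, P` the logarithm of the rank is of order `(r + q + B) log(mq)`, and `r = min(m,
⌊√(mq)⌋)` gives the claim (`log_rank_bound_le`). -/

namespace SpinChain

/-! ### Operators supported on sets of sites, and their tensor structure -/

section Support
variable {n d : ℕ}

theorem ActsOn.mul {X : Finset (Fin n)} {A B : Operator n d} (hA : ActsOn X A) (hB : ActsOn X B) :
    ActsOn X (A * B) := by
  classical
  obtain ⟨A', hA'⟩ := hA
  obtain ⟨B', hB'⟩ := hB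
  refine ⟨A' * B', fun s t => ?_⟩
  simp only [Matrix.mul_apply, hA', hB', ite_mul, mul_ite, zero_mul, mul_zero, ← ite_and]
  split_ifs with h
  · rw [← Finset.sum_filter]
    refine Finset.sum_bij' (fun u _ => fun j : X => u j)
      (fun v _ => fun j => if hj : j ∈ X then v ⟨j, hj⟩ else s j) ?_ ?_ ?_ ?_ ?_
    · simp
    · intro v _
      simp only [Finset.mem_filter, Finset.mem_univ, true_and]
      constructor <;> intro j hj <;> simp [hj, h]
    · intro u hu
      simp only [Finset.mem_filter, Finset.mem_univ, true_and] at hu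
      funext j
      by_cases hj : j ∈ X
      · simp [hj]
      · simp [hj, hu.2 j hj]
    · intro v _
      funext j
      simp
    · simp
  · refine Finset.sum_eq_zero fun u _ => if_neg fun hu => h fun j hj => ?_
    grind

/-- The algebra of the operators acting on the sites in `X`. -/
def opsOn (d : ℕ) (X : Finset (Fin n)) : Subalgebra ℂ (Operator n d) where
  carrier := {A | ActsOn X A}
  mul_mem' := ActsOn.mul
  add_mem' := by
    rintro A B ⟨A', hA⟩ ⟨B', hB⟩
    refine ⟨A' + B', fun s t => ?_⟩
    simp only [Matrix.add_apply, hA, hB]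
    split_ifs <;> simp
  algebraMap_mem' := fun c => by
    classical
    refine ⟨algebraMap ℂ _ c, fun s t => ?_⟩
    simp only [Matrix.algebraMap_matrix_apply, funext_iff]
    by_cases h : ∀ j, s j = t j
    · simp [h]
    · rw [if_neg h]
      split_ifs with h1 h2
      · exact absurd (fun j => if hj : j ∈ X then h2 ⟨j, hj⟩ else h1 j hj) h
      · rfl
      · rfl

theorem mem_opsOn {X : Finset (Fin n)} {A : Operator n d} : A ∈ opsOn d X ↔ ActsOn X A := Iff.rfl

/-- The operator `A ⊗ 1` for an operator `A` on the qudits in `X`. -/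
def extend (X : Finset (Fin n)) : Matrix (X → Fin d) (X → Fin d) ℂ →ₗ[ℂ] Operator n d where
  toFun A := Matrix.of fun s t =>
    if ∀ i, i ∉ X → s i = t i then A (fun i => s i) (fun i => t i) else 0
  map_add' A B := by
    ext s t
    simp only [Matrix.of_apply, Matrix.add_apply]
    split_ifs <;> simp
  map_smul' c A := by
    ext s t
    simp only [Matrix.of_apply, Matrix.smul_apply]
    split_ifs <;> simp

theorem extend_apply (X : Finset (Fin n)) (A : Matrix (X → Fin d) (X → Fin d) ℂ)
    (s t : Fin n → Fin d) : extend X A s t =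
      if ∀ i, i ∉ X → s i = t i then A (fun i => s i) (fun i => t i) else 0 := rfl

theorem range_extend (X : Finset (Fin n)) :
    LinearMap.range (extend (d := d) X) = Subalgebra.toSubmodule (opsOn d X) := by
  ext A
  simp only [LinearMap.mem_range, Subalgebra.mem_toSubmodule, mem_opsOn, ActsOn]
  refine exists_congr fun B => ⟨fun h s t => ?_, fun h => ?_⟩
  · rw [← h, extend_apply]
  · ext s t
    rw [h, extend_apply]

theorem finrank_opsOn_le (X : Finset (Fin n)) :
    Module.finrank ℂ (Subalgebra.toSubmodule (opsOn d X)) ≤ d ^ (2 * X.card) := by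
  rw [← range_extend]
  refine (LinearMap.finrank_range_le _).trans_eq ?_
  rw [Module.finrank_matrix]
  simp [two_mul, pow_add]

theorem opsOn_mono {X Y : Finset (Fin n)} (h : X ⊆ Y) : opsOn d X ≤ opsOn d Y := by
  classical
  rintro A ⟨B, hB⟩
  refine ⟨Matrix.of fun s t => if ∀ i (hi : i ∈ Y), i ∉ X → s ⟨i, hi⟩ = t ⟨i, hi⟩ then
    B (fun i => s ⟨i, h i.2⟩) (fun i => t ⟨i, h i.2⟩) else 0, fun s t => ?_⟩
  rw [hB, Matrix.of_apply, ← ite_and]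
  congr 1
  rw [eq_iff_iff]
  exact ⟨fun h1 => ⟨fun i hi => h1 i fun hX => hi (h hX), fun i _ => h1 i⟩,
    fun h1 i hi => if hY : i ∈ Y then h1.2 i hY hi else h1.1 i hY⟩

theorem extend_mul_extend {X Y : Finset (Fin n)} (h : Disjoint X Y)
    (A : Matrix (X → Fin d) (X → Fin d) ℂ) (B : Matrix (Y → Fin d) (Y → Fin d) ℂ)
    (s t : Fin n → Fin d) : (extend X A * extend Y B) s t =
      if ∀ i, i ∉ X → i ∉ Y → s i = t i then
        A (fun i => s i) (fun i => t i) * B (fun i => s i) (fun i => t i) else 0 := by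
  classical
  rw [Finset.disjoint_left] at h
  -- Only one intermediate configuration contributes: the first factor cannot change sites off `X`,
  -- the second cannot change sites of `X`.
  rw [Matrix.mul_apply, Finset.sum_eq_single (fun j => if j ∈ X then t j else s j)]
  · have h1 : (fun i : X => if (i : Fin n) ∈ X then t i else s i) = fun i : X => t i := by
      funext i; simp
    have h2 : (fun i : Y => if (i : Fin n) ∈ X then t i else s i) = fun i : Y => s i := by
      funext i; rw [if_neg fun hi => h hi i.2]
    rw [extend_apply, extend_apply, h1, h2, if_pos (fun i hi => by simp [hi]), mul_ite, mul_zero]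
    congr 1
    rw [eq_iff_iff]
    grind
  · intro u _ hu
    rw [extend_apply, extend_apply, ite_mul, zero_mul, mul_ite, mul_zero, ← ite_and, if_neg]
    intro h1
    apply hu
    funext j
    by_cases hj : j ∈ X
    · simp [hj, h1.2 j (h hj)]
    · simp [hj, h1.1 j hj]
  · simp

theorem commute_of_disjoint {X Y : Finset (Fin n)} (h : Disjoint X Y) {A B : Operator n d}
    (hA : A ∈ opsOn d X) (hB : B ∈ opsOn d Y) : Commute A B := by
  rw [← Subalgebra.mem_toSubmodule, ← range_extend] at hA hB
  obtain ⟨A, rfl⟩ := hA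
  obtain ⟨B, rfl⟩ := hB
  ext s t
  rw [extend_mul_extend h, extend_mul_extend h.symm, mul_comm]
  congr 1
  rw [eq_iff_iff]
  exact ⟨fun h i hi hj => h i hj hi, fun h i hi hj => h i hj hi⟩

theorem opsOn_union_le {X Y : Finset (Fin n)} (h : Disjoint X Y) :
    Subalgebra.toSubmodule (opsOn d (X ∪ Y)) ≤
      Subalgebra.toSubmodule (opsOn d X) * Subalgebra.toSubmodule (opsOn d Y) := by
  classical
  rw [← range_extend, ← range_extend, ← range_extend]
  rintro _ ⟨C, rfl⟩
  rw [Matrix.matrix_eq_sum_single C]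
  simp only [map_sum]
  refine Submodule.sum_mem _ fun x _ => Submodule.sum_mem _ fun y _ => ?_
  have hX : ∀ j : X, (j : Fin n) ∈ X ∪ Y := fun j => Finset.mem_union_left _ j.2
  have hY : ∀ j : Y, (j : Fin n) ∈ X ∪ Y := fun j => Finset.mem_union_right _ j.2
  have key : extend (X ∪ Y) (Matrix.single x y (C x y)) =
      extend X (Matrix.single (fun j => x ⟨j, hX j⟩) (fun j => y ⟨j, hX j⟩) (C x y)) *
      extend Y (Matrix.single (fun j => x ⟨j, hY j⟩) (fun j => y ⟨j, hY j⟩) 1) := by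
    ext s t
    rw [extend_mul_extend h, extend_apply]
    simp only [Matrix.single_apply, mul_ite, mul_one, mul_zero, ← ite_and]
    congr 1
    simp only [funext_iff, Subtype.forall, Finset.mem_union, eq_iff_iff]
    grind
  rw [key]
  exact Submodule.mul_mem_mul ⟨_, rfl⟩ ⟨_, rfl⟩

/-- Expanding the right factors in a basis of `U` leaves one product term per basis vector, however
many terms the original sum had. -/
theorem schmidtRank_le_finrank {A : Operator n d} {i : Fin n} {U : Submodule ℂ (Operator n d)}
    (hU : U ≤ Subalgebra.toSubmodule (opsOn d (Finset.Ioi i)))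
    (hA : A ∈ Subalgebra.toSubmodule (opsOn d (Finset.Iic i)) * U) :
    schmidtRank A i ≤ Module.finrank ℂ U := by
  refine Nat.sInf_le ?_
  let b := Module.finBasis ℂ U
  suffices h : ∃ P : Fin (Module.finrank ℂ U) → Operator n d,
      (∀ a, ActsOn (Finset.Iic i) (P a)) ∧ A = ∑ a, P a * b a by
    obtain ⟨P, hP, h⟩ := h
    exact ⟨P, fun a => b a, hP, fun a => hU (b a).2, h⟩
  refine Submodule.mul_induction_on hA (fun x hx u hu => ?_) ?_
  · refine ⟨fun a => b.repr ⟨u, hu⟩ a • x, fun a => Subalgebra.smul_mem (opsOn d _) hx _, ?_⟩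
    have h := congrArg Subtype.val (b.sum_repr ⟨u, hu⟩)
    simp only [AddSubmonoidClass.coe_finsetSum, SetLike.val_smul] at h
    conv_lhs => rw [← h]
    simp [Finset.mul_sum]
  · rintro x y ⟨P, hP, hx⟩ ⟨P', hP', hy⟩
    exact ⟨fun a => P a + P' a, fun a => Subalgebra.add_mem (opsOn d _) (hP a) (hP' a), by
      simp [hx, hy, add_mul, Finset.sum_add_distrib]⟩

end Support

/-! ### Dimension bounds for coefficients, graded by the number of crossings -/

section Graded
open Module AddMonoidAlgebra
variable {R G : Type*} [Ring R] [Algebra ℂ R] [AddMonoid G]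

theorem toSubmodule_mul_self (S : Subalgebra ℂ R) :
    Subalgebra.toSubmodule S * Subalgebra.toSubmodule S = Subalgebra.toSubmodule S :=
  S.isIdempotentElem_toSubmodule

theorem finrank_submodule_mul_le [FiniteDimensional ℂ R] (U V : Submodule ℂ R) :
    finrank ℂ ↥(U * V) ≤ finrank ℂ U * finrank ℂ V := by
  rw [← Submodule.mulMap_range U V, ← finrank_tensorProduct (R := ℂ)]
  exact LinearMap.finrank_range_le _

theorem finrank_submodule_pow_le [FiniteDimensional ℂ R] (U : Submodule ℂ R) (b : ℕ) :
    finrank ℂ ↥(U ^ b) ≤ finrank ℂ U ^ b := by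
  induction b with
  | zero =>
    rw [pow_zero, pow_zero, Submodule.one_eq_span]
    exact (finrank_span_le_card _).trans (by simp)
  | succ b ih =>
    rw [pow_succ, pow_succ]
    exact (finrank_submodule_mul_le _ _).trans (Nat.mul_le_mul_right _ ih)

theorem submodule_sum_le {ι : Type*} {s : Finset ι} {U : ι → Submodule ℂ R} {W : Submodule ℂ R}
    (h : ∀ a ∈ s, U a ≤ W) : ∑ a ∈ s, U a ≤ W := by
  classical
  induction s using Finset.induction_on with
  | empty => simp
  | insert a s ha ih =>
    rw [Finset.sum_insert ha]
    exact sup_le (h a (by simp)) (ih fun b hb => h b (by simp [hb]))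

theorem le_submodule_sum {ι : Type*} {s : Finset ι} (U : ι → Submodule ℂ R) {a : ι}
    (ha : a ∈ s) : U a ≤ ∑ a ∈ s, U a := by
  classical
  rw [← Finset.add_sum_erase s U ha]
  exact le_sup_left

theorem finrank_submodule_sum_le [FiniteDimensional ℂ R] {ι : Type*} (s : Finset ι)
    (U : ι → Submodule ℂ R) : finrank ℂ ↥(∑ a ∈ s, U a) ≤ ∑ a ∈ s, finrank ℂ (U a) := by
  classical
  induction s using Finset.induction_on with
  | empty =>
    rw [Finset.sum_empty, Finset.sum_empty, Submodule.zero_eq_bot, finrank_bot]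
  | insert a s ha ih =>
    rw [Finset.sum_insert ha, Finset.sum_insert ha, Submodule.add_eq_sup]
    exact (Submodule.finrank_add_le_finrank_add_finrank _ _).trans (Nat.add_le_add_left ih _)

theorem mem_mul_of_le {U V W : Submodule ℂ R} (h : V ≤ W) {x : R} (hx : x ∈ U * V) :
    x ∈ U * W :=
  (mul_le_mul' le_rfl h : U * V ≤ U * W) hx

theorem coeff_mul_mem {F F' : AddMonoidAlgebra R G} {W : Submodule ℂ R} {s : G}
    (h : ∀ a b, a + b = s → F.coeff a * F'.coeff b ∈ W) : (F * F').coeff s ∈ W := by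
  classical
  rw [AddMonoidAlgebra.mul_def]
  simp only [Finsupp.sum, coeff_sum, Finsupp.finsetSum_apply, coeff_single, Finsupp.single_apply]
  refine Submodule.sum_mem _ fun a _ => Submodule.sum_mem _ fun b _ => ?_
  split_ifs with hab
  exacts [h a b hab, W.zero_mem]

/-- Left operators move past `V` and merge into `𝓛`, so only the right-hand spaces multiply. -/
theorem submodule_mul_mul_mul_le {𝓛 𝓡 : Subalgebra ℂ R}
    (hcomm : ∀ x ∈ 𝓛, ∀ y ∈ 𝓡, Commute x y) {V V' : Submodule ℂ R}
    (hV : V ≤ Subalgebra.toSubmodule 𝓡) :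
    (Subalgebra.toSubmodule 𝓛 * V) * (Subalgebra.toSubmodule 𝓛 * V') ≤
      Subalgebra.toSubmodule 𝓛 * (V * V') := by
  have h : V * Subalgebra.toSubmodule 𝓛 ≤ Subalgebra.toSubmodule 𝓛 * V :=
    Submodule.mul_le.2 fun v hv l hl => by
      rw [← (hcomm l hl v (hV hv)).eq]
      exact Submodule.mul_mem_mul hl hv
  calc _ = Subalgebra.toSubmodule 𝓛 * (V * Subalgebra.toSubmodule 𝓛) * V' := by
        simp only [mul_assoc]
    _ ≤ Subalgebra.toSubmodule 𝓛 * (Subalgebra.toSubmodule 𝓛 * V) * V' := by gcongr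
    _ = (Subalgebra.toSubmodule 𝓛 * Subalgebra.toSubmodule 𝓛) * (V * V') := by
        simp only [mul_assoc]
    _ = _ := by rw [toSubmodule_mul_self]

/-- For commuting subalgebras `𝓛` and `𝓡`, the coefficients of degree `b ≤ B` of `F` with respect
to the weight `φ` lie in `𝓛 V_b` for a subspace `V_b` of `𝓡` of dimension at most `N β ^ b`. -/
def GradedBound (𝓛 𝓡 : Subalgebra ℂ R) (φ : G →+ ℕ) (B N β : ℕ) (F : AddMonoidAlgebra R G) :
    Prop :=
  ∃ V : ℕ → Submodule ℂ R, (∀ b, V b ≤ Subalgebra.toSubmodule 𝓡) ∧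
    (∀ b ≤ B, finrank ℂ (V b) ≤ N * β ^ b) ∧
    ∀ s, F.coeff s ∈ Subalgebra.toSubmodule 𝓛 * V (φ s)

variable {𝓛 𝓡 : Subalgebra ℂ R} {φ : G →+ ℕ} {B N N' β β' : ℕ} {F F' : AddMonoidAlgebra R G}

theorem GradedBound.mono (hN : N ≤ N') (hβ : β ≤ β') (h : GradedBound 𝓛 𝓡 φ B N β F) :
    GradedBound 𝓛 𝓡 φ B N' β' F := by
  obtain ⟨V, h1, h2, h3⟩ := h
  exact ⟨V, h1, fun b hb => (h2 b hb).trans (by gcongr), h3⟩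

theorem gradedBound_single_zero {a r : R} (hr : r ∈ 𝓡)
    (ha : a ∈ Subalgebra.toSubmodule 𝓛 * Submodule.span ℂ {r}) :
    GradedBound 𝓛 𝓡 φ B 1 β (single 0 a) := by
  classical
  obtain ⟨V, hV0, hV⟩ : ∃ V : ℕ → Submodule ℂ R, V 0 = Submodule.span ℂ {r} ∧
      ∀ b, b ≠ 0 → V b = ⊥ :=
    ⟨fun b => if b = 0 then Submodule.span ℂ {r} else ⊥, if_pos rfl, fun b hb => if_neg hb⟩
  refine ⟨V, fun b => ?_, fun b _ => ?_, fun s => ?_⟩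
  · by_cases hb : b = 0
    · rw [hb, hV0]
      simpa using hr
    · rw [hV b hb]
      exact bot_le
  · by_cases hb : b = 0
    · rw [hb, hV0]
      exact (finrank_span_le_card _).trans (by simp)
    · rw [hV b hb, finrank_bot]
      exact Nat.zero_le _
  · rw [coeff_single, Finsupp.single_apply]
    split_ifs with h0
    · rwa [← h0, map_zero, hV0]
    · exact Submodule.zero_mem _

theorem gradedBound_one : GradedBound 𝓛 𝓡 φ B 1 β (1 : AddMonoidAlgebra R G) := by
  refine gradedBound_single_zero (r := 1) 𝓡.one_mem ?_
  rw [← mul_one (1 : R)]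
  exact Submodule.mul_mem_mul 𝓛.one_mem (Submodule.subset_span (by simp))

/-- A degree `b ≤ B` splits between the factors in `b + 1 ≤ B + 1` ways, and the powers of `β`
combine to `β ^ b` in each of them. -/
theorem GradedBound.mul [FiniteDimensional ℂ R] (hcomm : ∀ x ∈ 𝓛, ∀ y ∈ 𝓡, Commute x y)
    (h : GradedBound 𝓛 𝓡 φ B N β F) (h' : GradedBound 𝓛 𝓡 φ B N' β F') :
    GradedBound 𝓛 𝓡 φ B ((B + 1) * (N * N')) β (F * F') := by
  obtain ⟨V, hV, hd, hF⟩ := h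
  obtain ⟨V', hV', hd', hF'⟩ := h'
  refine ⟨fun b => ∑ p ∈ Finset.HasAntidiagonal.antidiagonal b, V p.1 * V' p.2, fun b => ?_,
    fun b hb => ?_, fun s => ?_⟩
  · refine submodule_sum_le fun p _ => ?_
    rw [← toSubmodule_mul_self 𝓡]
    exact mul_le_mul' (hV _) (hV' _)
  · refine (finrank_submodule_sum_le _ _).trans ?_
    calc _ ≤ ∑ p ∈ Finset.HasAntidiagonal.antidiagonal b, N * N' * β ^ b := by
          refine Finset.sum_le_sum fun p hp => ?_
          rw [Finset.HasAntidiagonal.mem_antidiagonal] at hp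
          refine (finrank_submodule_mul_le _ _).trans
            ((Nat.mul_le_mul (hd p.1 (by omega)) (hd' p.2 (by omega))).trans_eq ?_)
          rw [← hp, pow_add]
          ring
      _ = (b + 1) * (N * N') * β ^ b := by
          rw [Finset.sum_const, Finset.Nat.card_antidiagonal, smul_eq_mul]
          ring
      _ ≤ _ := by gcongr
  · refine coeff_mul_mem fun a b hab => ?_
    have h1 := submodule_mul_mul_mul_le hcomm (V' := V' (φ b)) (hV (φ a))
      (Submodule.mul_mem_mul (hF a) (hF' b))
    have h2 : V (φ a) * V' (φ b) ≤
        ∑ p ∈ Finset.HasAntidiagonal.antidiagonal (φ s), V p.1 * V' p.2 :=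
      le_submodule_sum (fun p : ℕ × ℕ => V p.1 * V' p.2) (a := (φ a, φ b))
        (by rw [Finset.HasAntidiagonal.mem_antidiagonal, ← hab, map_add])
    exact mem_mul_of_le h2 h1

theorem GradedBound.pow [FiniteDimensional ℂ R] (hcomm : ∀ x ∈ 𝓛, ∀ y ∈ 𝓡, Commute x y)
    (h : GradedBound 𝓛 𝓡 φ B N β F) (q : ℕ) :
    GradedBound 𝓛 𝓡 φ B (((B + 1) * N) ^ q) β (F ^ q) := by
  induction q with
  | zero => simpa using gradedBound_one
  | succ q ih =>
    rw [pow_succ', pow_succ', mul_assoc]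
    exact h.mul hcomm ih

theorem GradedBound.list_prod [FiniteDimensional ℂ R] (hcomm : ∀ x ∈ 𝓛, ∀ y ∈ 𝓡, Commute x y)
    (l : List (AddMonoidAlgebra R G)) (h : ∀ F ∈ l, GradedBound 𝓛 𝓡 φ B N β F) :
    GradedBound 𝓛 𝓡 φ B (((B + 1) * N) ^ l.length) β l.prod := by
  induction l with
  | nil => simpa using gradedBound_one
  | cons F l ih =>
    rw [List.prod_cons, List.length_cons]
    refine ((h F (by simp)).mul hcomm (ih fun F' hF' => h F' (by simp [hF']))).mono ?_ le_rfl
    rw [pow_succ', mul_assoc]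

/-- The truncated Taylor expansion of the exponential in an algebra over `ℂ`. -/
noncomputable def expTrunc {A : Type*} [Semiring A] [Algebra ℂ A] (m : ℕ) (x : A) : A :=
  ∑ s ∈ Finset.range (m + 1), ((s.factorial : ℂ))⁻¹ • x ^ s

theorem map_expTrunc {A A' : Type*} [Semiring A] [Algebra ℂ A] [Semiring A'] [Algebra ℂ A']
    (f : A →ₐ[ℂ] A') (m : ℕ) (x : A) : f (expTrunc m x) = expTrunc m (f x) := by
  simp [expTrunc]

/-- In a word in the letters `x` (left), `y` (crossing) and `ρ` (right), all left parts are absorbed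
by `𝓛`. What remains is a product of powers of `ρ` separated by elements of `Q`, one for each `y`;
each exponent takes at most `m + 1` values. -/
theorem gradedBound_expTrunc [FiniteDimensional ℂ R] (hcomm : ∀ x ∈ 𝓛, ∀ y ∈ 𝓡, Commute x y)
    {Q : Submodule ℂ R} (hQ : Q ≤ Subalgebra.toSubmodule 𝓡) {x y z : AddMonoidAlgebra R G} {ρ : R}
    (hx : ∀ s, x.coeff s ∈ 𝓛 ∧ (φ s ≠ 0 → x.coeff s = 0))
    (hy : ∀ s, y.coeff s ∈ Subalgebra.toSubmodule 𝓛 * Q ∧ (φ s ≠ 1 → y.coeff s = 0))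
    (hρ : ρ ∈ 𝓡) (hz : z = x + y + single 0 ρ) (m : ℕ) :
    GradedBound 𝓛 𝓡 φ B (m + 1) (finrank ℂ Q * (m + 1)) (expTrunc m z) := by
  classical
  let E : ℕ → Submodule ℂ R := fun j =>
    Submodule.span ℂ ((Finset.range (j + 1)).image fun a => ρ ^ a : Finset R)
  have hE : ∀ j, E j ≤ Subalgebra.toSubmodule 𝓡 := fun j => by
    rw [Submodule.span_le]
    intro w hw
    simp only [Finset.coe_image, Set.mem_image] at hw
    obtain ⟨a, -, rfl⟩ := hw
    exact 𝓡.pow_mem hρ a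
  have hE1 : ∀ j, (1 : R) ∈ E j := fun j =>
    Submodule.subset_span (by
      simp only [Finset.coe_image, Set.mem_image]
      exact ⟨0, by simp, pow_zero ρ⟩)
  have hEmono : Monotone E := fun j j' h => by
    refine Submodule.span_mono ?_
    norm_cast
    exact Finset.image_subset_image (Finset.range_mono (by omega))
  have hEcard : finrank ℂ (E m) ≤ m + 1 := by
    refine (finrank_span_finset_le_card _).trans (Finset.card_image_le.trans ?_)
    simp
  have hEρ : ∀ j, ∀ w ∈ E j, ρ * w ∈ E (j + 1) := fun j w hw => by
    refine Submodule.span_induction ?_ ?_ ?_ ?_ hw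
    · intro w hw
      simp only [Finset.coe_image, Set.mem_image, Finset.coe_range, Set.mem_Iio] at hw
      obtain ⟨a, ha, rfl⟩ := hw
      refine Submodule.subset_span ?_
      simp only [Finset.coe_image, Set.mem_image, Finset.coe_range, Set.mem_Iio]
      exact ⟨a + 1, by omega, pow_succ' _ _⟩
    · simp
    · intro u v _ _ hu hv
      rw [mul_add]
      exact add_mem hu hv
    · intro c u _ hu
      rw [mul_smul_comm]
      exact Submodule.smul_mem _ _ hu
  have hρ1 : ρ ∈ Subalgebra.toSubmodule 𝓛 * Submodule.span ℂ {ρ} := by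
    simpa using Submodule.mul_mem_mul ((Subalgebra.mem_toSubmodule _).2 𝓛.one_mem)
      (Submodule.mem_span_singleton_self (R := ℂ) ρ)
  -- The right parts of words of length `j` with `b` crossings: `E j` is spanned by `ρ ^ a` for `a ≤
  -- j`. In the induction below, a new first letter `x` changes nothing, `y` opens a new factor `Q`,
  -- and `ρ` raises the leading exponent.
  let V : ℕ → ℕ → Submodule ℂ R := fun j b => E j * (Q * E j) ^ b
  have hQE : ∀ j b, (Q * E j) ^ b ≤ Subalgebra.toSubmodule 𝓡 := fun j b => by
    have h1 : Q * E j ≤ Subalgebra.toSubmodule 𝓡 := by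
      rw [← toSubmodule_mul_self 𝓡]
      exact mul_le_mul' hQ (hE j)
    induction b with
    | zero => simp
    | succ b ih =>
      rw [pow_succ, ← toSubmodule_mul_self 𝓡]
      exact mul_le_mul' ih h1
  have hV : ∀ j b, V j b ≤ Subalgebra.toSubmodule 𝓡 := fun j b => by
    rw [← toSubmodule_mul_self 𝓡]
    exact mul_le_mul' (hE j) (hQE j b)
  have hVmono : ∀ b, Monotone fun j => V j b := fun b j j' h =>
    mul_le_mul' (hEmono h) (pow_le_pow_left' (mul_le_mul_right (hEmono h) Q) b)
  have hpow : ∀ j s, (z ^ j).coeff s ∈ Subalgebra.toSubmodule 𝓛 * V j (φ s) := by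
    intro j
    induction j with
    | zero =>
      intro s
      rw [pow_zero, one_def, coeff_single, Finsupp.single_apply]
      split_ifs with h
      · rw [← h, map_zero, ← mul_one (1 : R)]
        refine Submodule.mul_mem_mul 𝓛.one_mem ?_
        simpa [V] using hE1 0
      · exact Submodule.zero_mem _
    | succ j ih =>
      intro s
      have hmul : z * z ^ j = x * z ^ j + y * z ^ j + single 0 ρ * z ^ j := by
        rw [← add_mul, ← add_mul, ← hz]
      rw [pow_succ', hmul]
      simp only [coeff_add, Finsupp.add_apply]
      refine add_mem (add_mem ?_ ?_) ?_
      · refine coeff_mul_mem fun a b hab => ?_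
        by_cases ha : φ a = 0
        · have h1 := Submodule.mul_mem_mul (M := Subalgebra.toSubmodule 𝓛) (hx a).1 (ih b)
          rw [← mul_assoc, toSubmodule_mul_self] at h1
          rw [← hab, map_add, ha, zero_add]
          exact mem_mul_of_le (hVmono _ j.le_succ) h1
        · rw [(hx a).2 ha, zero_mul]
          exact Submodule.zero_mem _
      · refine coeff_mul_mem fun a b hab => ?_
        by_cases ha : φ a = 1
        · have h1 := submodule_mul_mul_mul_le hcomm hQ (Submodule.mul_mem_mul (hy a).1 (ih b))
          rw [← hab, map_add, ha, add_comm 1]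
          refine mem_mul_of_le ?_ h1
          calc Q * V j (φ b) = 1 * (Q * E j) ^ (φ b + 1) := by
                simp only [V, one_mul]
                rw [pow_succ', mul_assoc]
            _ ≤ E j * (Q * E j) ^ (φ b + 1) := by
                gcongr
                rw [Submodule.one_le]
                exact hE1 j
            _ ≤ _ := hVmono _ j.le_succ
        · rw [(hy a).2 ha, zero_mul]
          exact Submodule.zero_mem _
      · refine coeff_mul_mem fun a b hab => ?_
        rw [coeff_single, Finsupp.single_apply]
        split_ifs with ha
        · rw [← hab, ← ha, zero_add]
          have h1 := submodule_mul_mul_mul_le hcomm (V := Submodule.span ℂ {ρ})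
            (by simpa using hρ) (Submodule.mul_mem_mul hρ1 (ih b))
          refine mem_mul_of_le ?_ h1
          simp only [V, ← mul_assoc]
          refine mul_le_mul' ?_ (pow_le_pow_left' (mul_le_mul_right (hEmono j.le_succ) Q) _)
          rw [Submodule.mul_le]
          intro u hu v hv
          obtain ⟨c, rfl⟩ := Submodule.mem_span_singleton.1 hu
          rw [smul_mul_assoc]
          exact Submodule.smul_mem _ _ (hEρ j v hv)
        · rw [zero_mul]
          exact Submodule.zero_mem _
  refine ⟨V m, hV m, fun b _ => ?_, fun s => ?_⟩
  · calc _ ≤ finrank ℂ (E m) * finrank ℂ ↥((Q * E m) ^ b) := finrank_submodule_mul_le _ _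
      _ ≤ (m + 1) * (finrank ℂ Q * (m + 1)) ^ b := by
        gcongr
        refine (finrank_submodule_pow_le _ _).trans ?_
        gcongr
        exact (finrank_submodule_mul_le _ _).trans (by gcongr)
  · simp only [expTrunc, coeff_sum, coeff_smul, Finsupp.finsetSum_apply, Finsupp.smul_apply]
    refine Submodule.sum_mem _ fun j hj => Submodule.smul_mem _ _ ?_
    exact mem_mul_of_le (hVmono _ (by simpa [Nat.lt_succ_iff] using hj)) (hpow j s)

end Graded

/-! ### Pigeonhole over the cuts -/

section Collapse
open AddMonoidAlgebra

/-- Forgetting the exponents with index larger than `t`. -/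
def collapse (t : ℕ) : (ℕ → ℕ) →+ (ℕ → ℕ) where
  toFun s j := if j ≤ t then s j else 0
  map_zero' := by funext j; simp
  map_add' s s' := by funext j; simp only [Pi.add_apply]; split_ifs <;> simp

theorem collapse_apply (t : ℕ) (s : ℕ → ℕ) (j : ℕ) :
    collapse t s j = if j ≤ t then s j else 0 := rfl

variable {R : Type*} [Ring R]

/-- The sum of the coefficients. -/
noncomputable def augmentation (R : Type*) [Ring R] [Algebra ℂ R] :
    AddMonoidAlgebra R (ℕ → ℕ) →ₐ[ℂ] R :=
  AddMonoidAlgebra.liftNCAlgHom (AlgHom.id ℂ R) 1 fun x _ => Commute.one_right x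

theorem augmentation_apply [Algebra ℂ R] (F : AddMonoidAlgebra R (ℕ → ℕ)) :
    augmentation R F = ∑ s ∈ F.coeff.support, F.coeff s := by
  change AddMonoidAlgebra.liftNC _ _ F = _
  simp [AddMonoidAlgebra.liftNC, Finsupp.liftAddHom, Finsupp.sum]

theorem augmentation_single [Algebra ℂ R] (s : ℕ → ℕ) (a : R) : augmentation R (single s a) = a := by
  change AddMonoidAlgebra.liftNC _ _ _ = _
  simp

/-- All the monomials of `F` have total degree at most `e` in the first `r` variables. -/
def DegreeLE (r e : ℕ) (F : AddMonoidAlgebra R (ℕ → ℕ)) : Prop :=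
  ∀ s, F.coeff s ≠ 0 → ∑ j ∈ Finset.range r, s j ≤ e

variable {r e e' : ℕ} {F F' : AddMonoidAlgebra R (ℕ → ℕ)}

theorem DegreeLE.mul [Algebra ℂ R] (hF : DegreeLE r e F) (hF' : DegreeLE r e' F') :
    DegreeLE r (e + e') (F * F') := by
  intro s hs
  by_contra! h
  refine hs ((Submodule.mem_bot ℂ).1 (coeff_mul_mem fun a b hab => ?_))
  rw [Submodule.mem_bot]
  by_contra h0
  have ha := hF a (left_ne_zero_of_mul h0)
  have hb := hF' b (right_ne_zero_of_mul h0)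
  subst hab
  simp only [Pi.add_apply, Finset.sum_add_distrib] at h
  omega

theorem degreeLE_single_zero (a : R) : DegreeLE r 0 (single 0 a) := by
  classical
  intro s hs
  rw [coeff_single, Finsupp.single_apply] at hs
  split_ifs at hs with h
  · simp [← h]
  · exact absurd rfl hs

theorem DegreeLE.pow [Algebra ℂ R] (hF : DegreeLE r e F) (q : ℕ) : DegreeLE r (q * e) (F ^ q) := by
  induction q with
  | zero => simpa [one_def] using degreeLE_single_zero (1 : R)
  | succ q ih =>
    rw [pow_succ, Nat.succ_mul]
    exact ih.mul hF

theorem DegreeLE.list_prod [Algebra ℂ R] (l : List (AddMonoidAlgebra R (ℕ → ℕ)))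
    (h : ∀ F ∈ l, DegreeLE r e F) : DegreeLE r (l.length * e) l.prod := by
  induction l with
  | nil => simpa [one_def] using degreeLE_single_zero (1 : R)
  | cons F l ih =>
    rw [List.prod_cons, List.length_cons, Nat.succ_mul, add_comm]
    exact (h F (by simp)).mul (ih fun F' hF' => h F' (by simp [hF']))

theorem DegreeLE.sum {ι : Type*} (s : Finset ι) (f : ι → AddMonoidAlgebra R (ℕ → ℕ))
    (h : ∀ a ∈ s, DegreeLE r e (f a)) : DegreeLE r e (∑ a ∈ s, f a) := by
  intro u hu
  rw [coeff_sum, Finsupp.finsetSum_apply] at hu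
  obtain ⟨a, ha, h0⟩ := Finset.exists_ne_zero_of_sum_ne_zero hu
  exact h a ha u h0

theorem DegreeLE.expTrunc [Algebra ℂ R] (hF : DegreeLE r 1 F) (m : ℕ) :
    DegreeLE r m (expTrunc m F) := by
  refine DegreeLE.sum _ _ fun j hj => fun s hs => ?_
  rw [coeff_smul_apply] at hs
  have h := hF.pow j s (fun h0 => hs (by rw [h0, smul_zero]))
  rw [Finset.mem_range] at hj
  omega

/-- Each monomial is assigned to the first variable whose exponent is at most `B`. Choosing the
first one makes the classes disjoint and lets membership be read off without the later variables. -/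
theorem augmentation_mem_sum [Algebra ℂ R] {B D : ℕ} (hD : D < r * (B + 1)) (hF : DegreeLE r D F)
    (W : ℕ → Submodule ℂ R)
    (hW : ∀ t < r, ∀ s, s t ≤ B → (mapDomainAlgHom ℂ R (collapse t) F).coeff s ∈ W t) :
    augmentation R F ∈ ∑ t ∈ Finset.range r, W t := by
  classical
  rw [augmentation_apply]
  -- The default `sInf ∅ = 0` never occurs on the support: if the first `r` exponents all exceeded
  -- `B`, the degree would be at least `r * (B + 1) > D`.
  let first : (ℕ → ℕ) → ℕ := fun s => sInf {t | s t ≤ B}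
  have hex : ∀ s ∈ F.coeff.support, ∃ t < r, s t ≤ B := by
    intro s hs
    by_contra! h
    have h1 := hF s (Finsupp.mem_support_iff.1 hs)
    have h2 : _ ≤ ∑ t ∈ Finset.range r, s t := Finset.card_nsmul_le_sum (Finset.range r) s (B + 1)
      fun t ht => h t (Finset.mem_range.1 ht)
    rw [Finset.card_range, smul_eq_mul] at h2
    omega
  have hfirst : ∀ s ∈ F.coeff.support, first s ∈ Finset.range r := by
    intro s hs
    obtain ⟨t, ht, hB⟩ := hex s hs
    exact Finset.mem_range.2 ((show first s ≤ t from Nat.sInf_le hB).trans_lt ht)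
  have hle : ∀ s ∈ F.coeff.support, s (first s) ≤ B := by
    intro s hs
    obtain ⟨t, -, hB⟩ := hex s hs
    exact Nat.sInf_mem (s := {t | s t ≤ B}) ⟨t, hB⟩
  rw [← Finset.sum_fiberwise_of_maps_to hfirst]
  refine Submodule.sum_mem _ fun t ht => le_submodule_sum W ht ?_
  rw [← Finset.sum_fiberwise_of_maps_to (t := (Finset.filter (fun s => first s = t)
    F.coeff.support).image (collapse t)) (g := collapse t)
    fun s hs => Finset.mem_image_of_mem _ hs]
  refine Submodule.sum_mem _ fun u hu => ?_
  obtain ⟨s₀, hs₀, rfl⟩ := Finset.mem_image.1 hu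
  rw [Finset.mem_filter] at hs₀
  have hs₀B : s₀ t ≤ B := by
    have := hle s₀ hs₀.1
    rwa [hs₀.2] at this
  have hmem := hW t (Finset.mem_range.1 ht) (collapse t s₀) (by simpa [collapse_apply] using hs₀B)
  convert hmem using 1
  rw [mapDomainAlgHom_apply, coeff_mapDomain, Finsupp.mapDomain, Finsupp.sum,
    Finsupp.finsetSum_apply, Finset.filter_filter, Finset.sum_filter]
  refine Finset.sum_congr rfl fun s hs => ?_
  rw [Finsupp.single_apply]
  congr 1
  rw [eq_iff_iff]
  -- Whether `first s = t` depends only on the exponents up to `t`, which `collapse t` keeps. So a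
  -- class is a union of whole fibres, and the sum over a fibre is one coefficient of the collapsed
  -- polynomial.
  refine ⟨fun h => h.2, fun h => ⟨?_, h⟩⟩
  have hj : ∀ j ≤ t, s j = s₀ j := fun j hj => by
    have := congrFun h j
    simpa [collapse_apply, hj] using this
  refine le_antisymm (Nat.sInf_le (by simpa [hj t le_rfl] using hs₀B)) ?_
  by_contra! hlt
  have h1 := hle s hs
  rw [hj _ hlt.le] at h1
  have h2 : first s₀ ≤ first s := Nat.sInf_le h1
  omega

end Collapse

/-! ### Local interactions and the family of cuts -/

section Hamiltonian
open AddMonoidAlgebra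

/-- The sites `x` with `a ≤ x < b`. -/
def sitesIco (n a b : ℕ) : Finset (Fin n) := {x : Fin n | a ≤ x ∧ (x : ℕ) < b}

theorem mem_sitesIco {n a b : ℕ} {x : Fin n} : x ∈ sitesIco n a b ↔ a ≤ x ∧ (x : ℕ) < b := by
  simp [sitesIco]

theorem card_sitesIco_le (n a b : ℕ) : (sitesIco n a b).card ≤ b - a := by
  rw [← Nat.card_Ico]
  refine Finset.card_le_card_of_injOn (fun x => (x : ℕ)) (fun x hx => ?_)
    fun x _ y _ h => Fin.ext h
  simpa [mem_sitesIco] using hx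

theorem disjoint_sitesIco (n a b c : ℕ) : Disjoint (sitesIco n a b) (sitesIco n b c) := by
  rw [Finset.disjoint_left]
  intro x hx hx'
  rw [mem_sitesIco] at hx hx'
  omega

theorem sitesIco_mono (n : ℕ) {a b a' b' : ℕ} (ha : a' ≤ a) (hb : b ≤ b') :
    sitesIco n a b ⊆ sitesIco n a' b' := by
  intro x hx
  rw [mem_sitesIco] at hx ⊢
  omega

theorem opsOn_sitesIco_le {n d : ℕ} (a b c : ℕ) :
    Subalgebra.toSubmodule (opsOn d (sitesIco n a c)) ≤
      Subalgebra.toSubmodule (opsOn d (sitesIco n a b)) *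
        Subalgebra.toSubmodule (opsOn d (sitesIco n b c)) := by
  refine le_trans (Subalgebra.toSubmodule.monotone (opsOn_mono fun x hx => ?_))
    (opsOn_union_le (disjoint_sitesIco n a b c))
  rw [mem_sitesIco] at hx
  rw [Finset.mem_union, mem_sitesIco, mem_sitesIco]
  omega

theorem finrank_opsOn_sitesIco_le {n d : ℕ} (hd : 1 ≤ d) (a b : ℕ) :
    Module.finrank ℂ (Subalgebra.toSubmodule (opsOn d (sitesIco n a b))) ≤ d ^ (2 * (b - a)) :=
  (finrank_opsOn_le _).trans
    (Nat.pow_le_pow_right hd (Nat.mul_le_mul_left _ (card_sitesIco_le n a b)))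

variable {n d k : ℕ} {g : ℝ}

/-- The linear combination `∑_X c_X h_X` of the interactions. -/
noncomputable def combination (H : LocalHamiltonian n d k g) (c : Finset (Fin n) → ℂ) :
    Operator n d :=
  ∑ X, c X • H.term X

/-- The linear combination `∑_X c_X h_X` with a monomial of exponent `w X` attached to `h_X`. -/
noncomputable def weighted (H : LocalHamiltonian n d k g) (c : Finset (Fin n) → ℂ)
    (w : Finset (Fin n) → ℕ → ℕ) : AddMonoidAlgebra (Operator n d) (ℕ → ℕ) :=
  ∑ X, single (w X) (c X • H.term X)

/-- The cuts to the left of the sites `p, p + k, …, p + (r - 1) k` that `X` crosses. -/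
noncomputable def crossings (n p k r : ℕ) (X : Finset (Fin n)) : ℕ → ℕ :=
  open Classical in fun t =>
    if t < r ∧ (∃ x ∈ X, (x : ℕ) < p + t * k) ∧ (∃ y ∈ X, p + t * k ≤ (y : ℕ)) then 1 else 0

theorem augmentation_weighted (H : LocalHamiltonian n d k g) (c : Finset (Fin n) → ℂ)
    (w : Finset (Fin n) → ℕ → ℕ) : augmentation _ (weighted H c w) = combination H c := by
  simp only [weighted, combination, map_sum, augmentation_single]

theorem degreeLE_weighted (H : LocalHamiltonian n d k g) (c : Finset (Fin n) → ℂ) (p r : ℕ) :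
    DegreeLE r 1 (weighted H c (crossings n p k r)) := by
  classical
  refine DegreeLE.sum _ _ fun X _ s hs => ?_
  rw [coeff_single, Finsupp.single_apply] at hs
  split_ifs at hs with h
  · subst h
    have hX : H.term X ≠ 0 := fun h0 => hs (by rw [h0, smul_zero])
    simp only [crossings]
    rw [← Finset.sum_filter, Finset.sum_const, smul_eq_mul, mul_one, Finset.card_le_one]
    -- Sites on both sides of a strip of width `k` would violate the range condition, so no nonzero
    -- interaction crosses two cuts.
    have key : ∀ t t' : ℕ, (∃ x ∈ X, (x : ℕ) < p + t * k) → (∃ y ∈ X, p + t' * k ≤ (y : ℕ)) →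
        t' ≤ t := by
      rintro t t' ⟨x, hx, hxt⟩ ⟨y, hy, hyt⟩
      have h1 := H.range X hX y hy x hx
      by_contra! hlt
      have h2 : (t + 1) * k ≤ t' * k := Nat.mul_le_mul_right k hlt
      rw [Nat.succ_mul] at h2
      omega
    intro t ht t' ht'
    rw [Finset.mem_filter] at ht ht'
    exact le_antisymm (key _ _ ht'.2.2.1 ht.2.2.2) (key _ _ ht.2.2.1 ht'.2.2.2)
  · exact absurd rfl hs

/-- Cuts before `t` tell apart only interactions to the left of cut `t`, which `𝓛` absorbs, and
later cuts are forgotten. Hence the right-hand space depends on the exponent of variable `t` alone.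
-/
theorem gradedBound_collapse_expTrunc_weighted (hd : 1 ≤ d) (H : LocalHamiltonian n d k g)
    (c : Finset (Fin n) → ℂ) {p r t : ℕ} (ht : t < r) (B m : ℕ) :
    GradedBound (opsOn d (sitesIco n 0 (p + t * k))) (opsOn d (sitesIco n (p + t * k) n))
      (Pi.evalAddMonoidHom (fun _ : ℕ => ℕ) t) B (m + 1) (d ^ (2 * k) * (m + 1))
      (mapDomainAlgHom ℂ _ (collapse t) (expTrunc m (weighted H c (crossings n p k r)))) := by
  classical
  set a := p + t * k with ha
  let IsLeft : Finset (Fin n) → Prop := fun X => X ⊆ sitesIco n 0 a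
  let IsRight : Finset (Fin n) → Prop := fun X => X ⊆ sitesIco n a n
  let w : Finset (Fin n) → ℕ → ℕ := fun X => collapse t (crossings n p k r X)
  let f : Finset (Fin n) → AddMonoidAlgebra (Operator n d) (ℕ → ℕ) := fun X =>
    single (w X) (c X • H.term X)
  rw [map_expTrunc]
  have hmap : mapDomainAlgHom ℂ _ (collapse t) (weighted H c (crossings n p k r)) = ∑ X, f X := by
    simp only [weighted, map_sum, mapDomainAlgHom_apply, mapDomain_single, f, w]
  rw [hmap]
  have hcomm : ∀ x ∈ opsOn d (sitesIco n 0 a), ∀ y ∈ opsOn d (sitesIco n a n), Commute x y :=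
    fun x hx y hy => commute_of_disjoint (disjoint_sitesIco n 0 a n) hx hy
  have hwleft : ∀ X, IsLeft X → w X t = 0 := by
    intro X hX
    simp only [w, collapse_apply, crossings, le_refl, if_true]
    rw [if_neg]
    rintro ⟨-, -, y, hy, hya⟩
    have := mem_sitesIco.1 (hX hy)
    omega
  have hwcross : ∀ X, ¬ IsLeft X → ¬ IsRight X → w X t = 1 := by
    intro X hX hX'
    simp only [w, collapse_apply, crossings, le_refl, if_true]
    rw [if_pos]
    refine ⟨ht, ?_, ?_⟩
    · obtain ⟨x, hx, hxa⟩ := Finset.not_subset.1 hX'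
      rw [mem_sitesIco] at hxa
      exact ⟨x, hx, by omega⟩
    · obtain ⟨x, hx, hxa⟩ := Finset.not_subset.1 hX
      rw [mem_sitesIco] at hxa
      exact ⟨x, hx, by omega⟩
  -- This is where forgetting the later cuts is needed: it lets all interactions on the right merge
  -- into the single operator `ρ`.
  have hwright : ∀ X, IsRight X → w X = 0 := by
    intro X hX
    funext j
    simp only [w, collapse_apply, crossings, Pi.zero_apply]
    split_ifs with hj h
    · obtain ⟨-, ⟨x, hx, hxa⟩, -⟩ := h
      have h1 := mem_sitesIco.1 (hX hx)
      have h2 : j * k ≤ t * k := Nat.mul_le_mul_right k hj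
      omega
    · rfl
    · rfl
  have hterm : ∀ {Y : Finset (Fin n)} X, X ⊆ Y → c X • H.term X ∈ opsOn d Y := fun X hX =>
    Subalgebra.smul_mem _ (opsOn_mono hX (mem_opsOn.2 (H.actsOn X))) _
  -- The empty set is both left and right; it is counted as left, so that the three sums partition
  -- all `X`.
  let x := ∑ X with IsLeft X, f X
  let y := ∑ X with ¬ IsLeft X ∧ ¬ IsRight X, f X
  let ρ := ∑ X with ¬ IsLeft X ∧ IsRight X, c X • H.term X
  refine (gradedBound_expTrunc hcomm
    (Q := Subalgebra.toSubmodule (opsOn d (sitesIco n a (a + k)))) (x := x) (y := y) (ρ := ρ)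
    ?_ ?_ ?_ ?_ ?_ m).mono le_rfl ?_
  · refine Subalgebra.toSubmodule.monotone (opsOn_mono fun x hx => ?_)
    rw [mem_sitesIco] at hx ⊢
    exact ⟨hx.1, x.2⟩
  · intro s
    simp only [x, f, coeff_sum, Finsupp.finsetSum_apply, coeff_single, Finsupp.single_apply]
    constructor
    · refine Subalgebra.sum_mem _ fun X hX => ?_
      split_ifs
      · exact hterm X (Finset.mem_filter.1 hX).2
      · exact Subalgebra.zero_mem _
    · intro hs
      refine Finset.sum_eq_zero fun X hX => if_neg ?_
      rintro rfl
      exact hs (hwleft X (Finset.mem_filter.1 hX).2)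
  · intro s
    simp only [y, f, coeff_sum, Finsupp.finsetSum_apply, coeff_single, Finsupp.single_apply]
    constructor
    · refine Submodule.sum_mem _ fun X hX => ?_
      split_ifs
      · by_cases h0 : H.term X = 0
        · rw [h0, smul_zero]
          exact Submodule.zero_mem _
        obtain ⟨hl, hr⟩ := (Finset.mem_filter.1 hX).2
        obtain ⟨z, hz, hza⟩ := Finset.not_subset.1 hr
        rw [mem_sitesIco] at hza
        refine opsOn_sitesIco_le 0 a (a + k) (hterm X fun v hv => ?_)
        have := H.range X h0 v hv z hz
        rw [mem_sitesIco]
        omega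
      · exact Submodule.zero_mem _
    · intro hs
      refine Finset.sum_eq_zero fun X hX => if_neg ?_
      rintro rfl
      obtain ⟨hl, hr⟩ := (Finset.mem_filter.1 hX).2
      exact hs (hwcross X hl hr)
  · exact Subalgebra.sum_mem _ fun X hX => hterm X (Finset.mem_filter.1 hX).2.2
  · have h1 : single 0 ρ = ∑ X with ¬ IsLeft X ∧ IsRight X, f X := by
      change singleAddHom 0 ρ = _
      rw [map_sum]
      refine Finset.sum_congr rfl fun X hX => ?_
      simp only [f, hwright X (Finset.mem_filter.1 hX).2.2, singleAddHom_apply]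
    rw [h1, ← Finset.sum_filter_add_sum_filter_not Finset.univ IsLeft f, add_assoc]
    congr 1
    rw [← Finset.sum_filter_add_sum_filter_not (Finset.filter (fun X => ¬ IsLeft X) _) IsRight f,
      add_comm, Finset.filter_filter, Finset.filter_filter]
  · gcongr
    simpa using finrank_opsOn_sitesIco_le (n := n) hd a (a + k)

theorem schmidtRank_pow_le (hd : 1 ≤ d) (H : LocalHamiltonian n d k g) (i : Fin n)
    (l : List (Finset (Fin n) → ℂ)) (m q r B : ℕ) (hB : q * (l.length * m) < r * (B + 1))
    {A D : Operator n d} (hA : A ∈ opsOn d (sitesIco n 0 (i + 1)))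
    (hD : D ∈ opsOn d (sitesIco n (i + 1 + r * k) n)) :
    schmidtRank ((A * (l.map fun c => expTrunc m (combination H c)).prod * D) ^ q) i ≤
      r * (d ^ (2 * (r * k)) * ((B + 1) * (((B + 1) ^ 3 * ((B + 1) * (m + 1)) ^ l.length) ^ q *
        (d ^ (2 * k) * (m + 1)) ^ B))) := by
  classical
  set N := ((B + 1) ^ 3 * ((B + 1) * (m + 1)) ^ l.length) ^ q with hN
  set β := d ^ (2 * k) * (m + 1) with hβ
  have hβ1 : 1 ≤ β := Nat.mul_pos (Nat.pow_pos hd) m.succ_pos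
  let p : ℕ := i + 1
  let F : AddMonoidAlgebra (Operator n d) (ℕ → ℕ) := (single 0 A *
    (l.map fun c => expTrunc m (weighted H c (crossings n p k r))).prod * single 0 D) ^ q
  have haug : augmentation _ F =
      (A * (l.map fun c => expTrunc m (combination H c)).prod * D) ^ q := by
    simp only [F, map_pow, map_mul, augmentation_single, map_list_prod, List.map_map]
    congr 4
    refine List.map_congr_left fun c _ => ?_
    rw [Function.comp_apply, map_expTrunc, augmentation_weighted]
  have hdeg : DegreeLE r (q * (l.length * m)) F := by
    refine DegreeLE.pow ?_ q
    have h := DegreeLE.list_prod (r := r) (e := m)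
      (l.map fun c => expTrunc m (weighted H c (crossings n p k r))) fun G hG => by
        obtain ⟨c, -, rfl⟩ := List.mem_map.1 hG
        exact (degreeLE_weighted H c p r).expTrunc m
    rw [List.length_map] at h
    simpa using ((degreeLE_single_zero (r := r) A).mul h).mul (degreeLE_single_zero D)
  have hgraded : ∀ t < r, GradedBound (opsOn d (sitesIco n 0 (p + t * k)))
      (opsOn d (sitesIco n (p + t * k) n)) (Pi.evalAddMonoidHom (fun _ : ℕ => ℕ) t) B N β
      (mapDomainAlgHom ℂ _ (collapse t) F) := by
    intro t ht
    have hcomm : ∀ x ∈ opsOn d (sitesIco n 0 (p + t * k)),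
        ∀ y ∈ opsOn d (sitesIco n (p + t * k) n), Commute x y :=
      fun x hx y hy => commute_of_disjoint (disjoint_sitesIco n 0 _ n) hx hy
    simp only [F, map_pow, map_mul, map_list_prod, List.map_map]
    have hleft : GradedBound (opsOn d (sitesIco n 0 (p + t * k)))
        (opsOn d (sitesIco n (p + t * k) n)) (Pi.evalAddMonoidHom (fun _ : ℕ => ℕ) t) B 1 β
        (mapDomainAlgHom ℂ _ (collapse t) (single 0 A)) := by
      rw [mapDomainAlgHom_apply, mapDomain_single, map_zero]
      refine gradedBound_single_zero (r := 1) (Subalgebra.one_mem _) ?_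
      have h := Submodule.mul_mem_mul ((Subalgebra.mem_toSubmodule _).2
        (opsOn_mono (d := d) (sitesIco_mono n le_rfl (Nat.le_add_right p (t * k))) hA))
        (Submodule.mem_span_singleton_self (R := ℂ) (1 : Operator n d))
      rwa [mul_one] at h
    have hright : GradedBound (opsOn d (sitesIco n 0 (p + t * k)))
        (opsOn d (sitesIco n (p + t * k) n)) (Pi.evalAddMonoidHom (fun _ : ℕ => ℕ) t) B 1 β
        (mapDomainAlgHom ℂ _ (collapse t) (single 0 D)) := by
      rw [mapDomainAlgHom_apply, mapDomain_single, map_zero]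
      have hD' := opsOn_mono (d := d) (sitesIco_mono n
        (Nat.add_le_add_left (Nat.mul_le_mul_right k ht.le) p) le_rfl) hD
      refine gradedBound_single_zero hD' ?_
      have h := Submodule.mul_mem_mul ((Subalgebra.mem_toSubmodule _).2
        (Subalgebra.one_mem (opsOn d (sitesIco n 0 (p + t * k)))))
        (Submodule.mem_span_singleton_self (R := ℂ) D)
      rwa [one_mul] at h
    have hmid := GradedBound.list_prod (B := B) (N := m + 1) (β := β)
      (φ := Pi.evalAddMonoidHom (fun _ : ℕ => ℕ) t) hcomm
      (l.map (⇑(mapDomainAlgHom ℂ _ (collapse t)) ∘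
        fun c => expTrunc m (weighted H c (crossings n p k r)))) fun G hG => by
        obtain ⟨c, -, rfl⟩ := List.mem_map.1 hG
        exact gradedBound_collapse_expTrunc_weighted hd H c ht B m
    rw [List.length_map] at hmid
    -- The cube of `B + 1` collects the products with `A` and with `D`, and the one product per step
    -- of the `q`-th power.
    refine (((hleft.mul hcomm hmid).mul hcomm hright).pow hcomm q).mono (le_of_eq ?_) le_rfl
    rw [hN]
    ring
  choose! V hVR hVd hVF using hgraded
  let U : ℕ → Submodule ℂ (Operator n d) := fun t => ∑ b ∈ Finset.range (B + 1), V t b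
  let M : ℕ → Submodule ℂ (Operator n d) := fun t =>
    Subalgebra.toSubmodule (opsOn d (sitesIco n p (p + t * k)))
  let L := Subalgebra.toSubmodule (opsOn d (sitesIco n 0 p))
  -- The cut returns from `p + t * k` to `p`: the operators `M t` on the sites in between join the
  -- right side and cost at most `d ^ (2 * (r * k))` dimensions.
  have hmem : augmentation _ F ∈ ∑ t ∈ Finset.range r, L * (M t * U t) := by
    refine augmentation_mem_sum hB hdeg _ fun t ht s hs => ?_
    have h1 : V t (s t) ≤ U t :=
      le_submodule_sum (V t) (Finset.mem_range.2 (Nat.lt_succ_of_le hs))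
    rw [← mul_assoc]
    exact mul_le_mul' (opsOn_sitesIco_le 0 p (p + t * k)) h1 (hVF t ht s)
  rw [← Finset.mul_sum, haug] at hmem
  have hLeft : sitesIco n 0 p = Finset.Iic i := by
    ext x
    rw [mem_sitesIco, Finset.mem_Iic, Fin.le_def]
    omega
  have hRight : sitesIco n p n = Finset.Ioi i := by
    ext x
    rw [mem_sitesIco, Finset.mem_Ioi, Fin.lt_def]
    omega
  simp only [L, hLeft] at hmem
  refine (schmidtRank_le_finrank ?_ hmem).trans ?_
  · rw [← hRight]
    refine submodule_sum_le fun t ht => ?_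
    rw [← toSubmodule_mul_self (opsOn d (sitesIco n p n))]
    refine mul_le_mul' (Subalgebra.toSubmodule.monotone (opsOn_mono fun x hx => ?_))
      (submodule_sum_le fun b _ => (hVR t (Finset.mem_range.1 ht) b).trans
        (Subalgebra.toSubmodule.monotone (opsOn_mono (sitesIco_mono n (by omega) le_rfl))))
    rw [mem_sitesIco] at hx ⊢
    exact ⟨hx.1, x.2⟩
  · refine (finrank_submodule_sum_le _ _).trans ?_
    refine (Finset.sum_le_card_nsmul _ _ (d ^ (2 * (r * k)) * ((B + 1) * (N * β ^ B)))
      fun t ht => ?_).trans_eq (by rw [Finset.card_range, smul_eq_mul])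
    rw [Finset.mem_range] at ht
    refine (finrank_submodule_mul_le _ _).trans (Nat.mul_le_mul ?_ ?_)
    · refine (finrank_opsOn_sitesIco_le hd _ _).trans (Nat.pow_le_pow_right hd ?_)
      have := Nat.mul_le_mul_right k ht.le
      omega
    · refine (finrank_submodule_sum_le _ _).trans ?_
      refine (Finset.sum_le_card_nsmul _ _ (N * β ^ B) fun b hb => ?_).trans_eq
        (by rw [Finset.card_range, smul_eq_mul])
      rw [Finset.mem_range, Nat.lt_succ_iff] at hb
      exact (hVd t ht b hb).trans (Nat.mul_le_mul_left _ (Nat.pow_le_pow_right hβ1 hb))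

end Hamiltonian

/-! ### The strip inside the product of local factors -/

section Gibbs
variable {n d k : ℕ} {g : ℝ}

theorem expTrunc_mem {A : Type*} [Ring A] [Algebra ℂ A] {S : Subalgebra ℂ A} {x : A} (hx : x ∈ S)
    (m : ℕ) : expTrunc m x ∈ S :=
  S.sum_mem fun _ _ => S.smul_mem (S.pow_mem hx _) _

/-- The coefficients of `H_j` as a linear combination of the interactions. -/
noncomputable def blockCoeff (n ℓ j : ℕ) : Finset (Fin n) → ℂ := fun X =>
  (if X ⊆ block n ℓ j then 1 else 0) +
    if (X ∩ block n ℓ j).Nonempty ∧ (X ∩ block n ℓ (j + 1)).Nonempty then 1 else 0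

theorem blockHamiltonian_eq_combination (H : LocalHamiltonian n d k g) (ℓ j : ℕ) :
    blockHamiltonian H ℓ j = combination H (blockCoeff n ℓ j) := by
  simp only [blockHamiltonian, combination, blockCoeff, add_smul, ite_smul, one_smul, zero_smul,
    Finset.sum_add_distrib, Finset.sum_filter]

theorem localFactor_eq (H : LocalHamiltonian n d k g) (β : ℝ) (ℓ m a : ℕ) :
    localFactor H β ℓ m a = expTrunc m (combination H ((β : ℂ) • blockCoeff n ℓ a)) *
      expTrunc m (combination H (-(β : ℂ) • (blockCoeff n ℓ a + blockCoeff n ℓ (a + 1)))) := by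
  have h : ∀ (b : ℂ) c, combination H (b • c) = b • combination H c := fun b c => by
    simp only [combination, Finset.smul_sum, Pi.smul_apply, smul_eq_mul, mul_smul]
  have h' : ∀ c c', combination H (c + c') = combination H c + combination H c' := fun c c' => by
    simp only [combination, Pi.add_apply, add_smul, Finset.sum_add_distrib]
  rw [h, h, h', ← blockHamiltonian_eq_combination, ← blockHamiltonian_eq_combination]
  rfl

theorem blockHamiltonian_mem (H : LocalHamiltonian n d k g) {ℓ j : ℕ} {S : Finset (Fin n)}
    (hS : ∀ x ∈ block n ℓ j, ∀ y : Fin n, (x : ℕ) + 1 ≤ y + k → (y : ℕ) + 1 ≤ x + k → y ∈ S) :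
    blockHamiltonian H ℓ j ∈ opsOn d S := by
  have key : ∀ X : Finset (Fin n), (H.term X ≠ 0 → ∃ x ∈ X, x ∈ block n ℓ j) →
      H.term X ∈ opsOn d S := by
    intro X hX
    by_cases h0 : H.term X = 0
    · rw [h0]
      exact Subalgebra.zero_mem _
    · obtain ⟨x, hx, hxj⟩ := hX h0
      exact opsOn_mono (fun y hy => hS x hxj y (H.range X h0 x hx y hy) (H.range X h0 y hy x hx))
        (mem_opsOn.2 (H.actsOn X))
  refine Subalgebra.add_mem _ (Subalgebra.sum_mem _ fun X hX => key X fun h0 => ?_)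
    (Subalgebra.sum_mem _ fun X hX => key X fun _ => ?_)
  · have hne : X.Nonempty := by
      rw [Finset.nonempty_iff_ne_empty]
      rintro rfl
      exact h0 H.term_empty
    obtain ⟨x, hx⟩ := hne
    exact ⟨x, hx, (Finset.mem_filter.1 hX).2 hx⟩
  · obtain ⟨x, hx⟩ := (Finset.mem_filter.1 hX).2.1
    exact ⟨x, (Finset.mem_inter.1 hx).1, (Finset.mem_inter.1 hx).2⟩

theorem localFactor_mem (H : LocalHamiltonian n d k g) {β : ℝ} {ℓ a : ℕ} {S : Subalgebra ℂ _}
    (h : blockHamiltonian H ℓ a ∈ S) (h' : blockHamiltonian H ℓ (a + 1) ∈ S) (m : ℕ) :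
    localFactor H β ℓ m a ∈ S :=
  S.mul_mem (expTrunc_mem (S.smul_mem h _) m) (expTrunc_mem (S.smul_mem (S.add_mem h h') _) m)

theorem localFactor_mem_left (H : LocalHamiltonian n d k g) (β : ℝ) {ℓ a c : ℕ}
    (h : (a + 1) * ℓ + k ≤ c) (m : ℕ) :
    localFactor H β ℓ m a ∈ opsOn d (sitesIco n 0 c) := by
  have key : ∀ j, j * ℓ + k ≤ c → blockHamiltonian H ℓ j ∈ opsOn d (sitesIco n 0 c) := by
    refine fun j hj => blockHamiltonian_mem H fun x hx y _ hy => ?_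
    rw [block, Finset.mem_filter] at hx
    rw [mem_sitesIco]
    omega
  refine localFactor_mem H (key a ?_) (key _ h) m
  rw [Nat.succ_mul] at h
  omega

theorem localFactor_mem_right (H : LocalHamiltonian n d k g) (β : ℝ) {ℓ a c : ℕ}
    (h : c + k + ℓ ≤ a * ℓ) (m : ℕ) :
    localFactor H β ℓ m a ∈ opsOn d (sitesIco n c n) := by
  have key : ∀ j, c + k + ℓ ≤ j * ℓ → blockHamiltonian H ℓ j ∈ opsOn d (sitesIco n c n) := by
    refine fun j hj => blockHamiltonian_mem H fun x hx y hy _ => ?_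
    rw [block, Finset.mem_filter] at hx
    rw [mem_sitesIco]
    omega
  refine localFactor_mem H (key a h) (key _ ?_) m
  rw [Nat.succ_mul]
  omega

theorem exists_gibbsMPO_eq (H : LocalHamiltonian n d k g) (β : ℝ) (ℓ m r K : ℕ) (hk : 1 ≤ k)
    (hkK : k ≤ K * ℓ) (hrK : r * k ≤ K * ℓ) (i : Fin n) :
    ∃ (A D : Operator n d) (l : List (Finset (Fin n) → ℂ)),
      A ∈ opsOn d (sitesIco n 0 (i + 1)) ∧ D ∈ opsOn d (sitesIco n (i + 1 + r * k) n) ∧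
      l.length ≤ 6 * K + 6 ∧
      gibbsMPO H β ℓ m = A * (l.map fun c => expTrunc m (combination H c)).prod * D := by
  have hℓ : 0 < ℓ := Nat.pos_of_ne_zero fun h => by simp [h] at hkK; omega
  set N := numBlocks n ℓ
  obtain ⟨a₀, h₀, h₀'⟩ : ∃ a₀, a₀ * ℓ ≤ i ∧ (i : ℕ) < (a₀ + 1) * ℓ :=
    ⟨i / ℓ, Nat.div_mul_le_self _ _, (Nat.div_lt_iff_lt_mul hℓ).1 (Nat.lt_succ_self _)⟩
  -- Factor `a` acts within distance less than `k ≤ K * ℓ` of the blocks `a` and `a + 1`. Before `u`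
  -- it stays left of the cut at `i`. From `v` on, `K` blocks of margin cover the strip and `K` more
  -- the interaction range. The `3 * K + 3` factors in between have two Taylor polynomials each.
  obtain ⟨u, v, huv, hvN, hu, hv, hlen⟩ : ∃ u v, u ≤ v ∧ v ≤ N ∧ (∀ a < u, a + K + 2 ≤ a₀) ∧
      (∀ a < N, v ≤ a → a₀ + 2 * K + 2 ≤ a) ∧ v - u ≤ 3 * K + 3 :=
    ⟨min (a₀ - (K + 1)) N, min (a₀ + 2 * K + 2) N, min_le_min (by omega) le_rfl,
      min_le_right _ _, fun a _ => by omega,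
      fun a _ _ => by omega, by omega⟩
  let c : ℕ → List (Finset (Fin n) → ℂ) := fun a => [(β : ℂ) • blockCoeff n ℓ a,
    -(β : ℂ) • (blockCoeff n ℓ a + blockCoeff n ℓ (a + 1))]
  have hc : ∀ l : List ℕ, ((l.flatMap c).map fun c => expTrunc m (combination H c)).prod =
      (l.map (localFactor H β ℓ m)).prod := by
    intro l
    induction l with
    | nil => rfl
    | cons a l ih =>
      rw [List.flatMap_cons, List.map_append, List.prod_append, ih]
      simp [c, localFactor_eq]
  refine ⟨((List.range' 0 u).map (localFactor H β ℓ m)).prod,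
    ((List.range' v (N - v)).map (localFactor H β ℓ m)).prod,
    (List.range' u (v - u)).flatMap c, ?_, ?_, ?_, ?_⟩
  · refine Subalgebra.list_prod_mem _ fun x hx => ?_
    obtain ⟨a, ha, rfl⟩ := List.mem_map.1 hx
    rw [List.mem_range'_1] at ha
    have h1 : (a + K + 2) * ℓ ≤ a₀ * ℓ := Nat.mul_le_mul_right ℓ (hu a (by omega))
    refine localFactor_mem_left H β ?_ m
    nlinarith
  · refine Subalgebra.list_prod_mem _ fun x hx => ?_
    obtain ⟨a, ha, rfl⟩ := List.mem_map.1 hx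
    rw [List.mem_range'_1] at ha
    have h1 : (a₀ + 2 * K + 2) * ℓ ≤ a * ℓ :=
      Nat.mul_le_mul_right ℓ (hv a (by omega) (by omega))
    refine localFactor_mem_right H β ?_ m
    nlinarith
  · rw [List.length_flatMap]
    simp only [c, List.length_cons, List.length_nil, List.map_const', List.sum_replicate,
      List.length_range', smul_eq_mul]
    omega
  · rw [hc, ← List.prod_append, ← List.map_append, ← List.prod_append, ← List.map_append,
      gibbsMPO, List.range_eq_range']
    congr 2
    have h1 := List.range'_append_1 (s := 0) (m := u) (n := v - u)
    have h2 := List.range'_append_1 (s := 0) (m := v) (n := N - v)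
    rw [zero_add] at h1 h2
    rw [h1, Nat.add_sub_cancel' huv, h2, Nat.add_sub_cancel' hvN]

theorem schmidtRank_gibbsMPO_pow_le (hd : 1 ≤ d) (hk : 1 ≤ k) (H : LocalHamiltonian n d k g)
    (β : ℝ) (ℓ m q r B K : ℕ) (hkK : k ≤ K * ℓ) (hrK : r * k ≤ K * ℓ)
    (hB : q * ((6 * K + 6) * m) < r * (B + 1)) (i : Fin n) :
    schmidtRank (gibbsMPO H β ℓ m ^ q) i ≤
      r * (d ^ (2 * (r * k)) * ((B + 1) * (((B + 1) ^ 3 * ((B + 1) * (m + 1)) ^ (6 * K + 6)) ^ q *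
        (d ^ (2 * k) * (m + 1)) ^ B))) := by
  obtain ⟨A, D, l, hA, hD, hl, h⟩ := exists_gibbsMPO_eq H β ℓ m r K hk hkK hrK i
  rw [h]
  have hB' : q * (l.length * m) < r * (B + 1) := lt_of_le_of_lt (by gcongr) hB
  refine (schmidtRank_pow_le hd H i l m q r B hB' hA hD).trans ?_
  gcongr
  exact Nat.mul_pos B.succ_pos m.succ_pos

theorem schmidtRank_one_le (i : Fin n) : schmidtRank (1 : Operator n d) i ≤ 1 := by
  refine (schmidtRank_le_finrank (U := Submodule.span ℂ {1}) ?_ ?_).trans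
    ((finrank_span_le_card _).trans (by simp))
  · simp
  · simpa using Submodule.mul_mem_mul ((Subalgebra.mem_toSubmodule _).2
      (Subalgebra.one_mem (opsOn d (Finset.Iic i))))
      (Submodule.mem_span_singleton_self (R := ℂ) (1 : Operator n d))

end Gibbs

/-! ### Numerical estimates -/

section Estimates

theorem taylorDegree_mul_le {c₀ c₁ : ℝ} (hc₀ : 0 < c₀) (hc₁ : 0 < c₁) (k : ℕ) {n : ℕ} (hn : 1 ≤ n)
    {ε : ℝ} (hε : 0 < ε) (hε1 : ε ≤ 1) :
    1 ≤ taylorDegree c₁ n ε ∧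
      taylorDegree c₁ n ε * k ≤ ⌈(c₁ + 1) / c₀⌉₊ * blockLength c₀ k n ε := by
  have hn' : (1 : ℝ) ≤ n := by exact_mod_cast hn
  -- `6n/ε ≥ 6 > e`; this absorbs the rounding in `m ≤ c₁ L + 1 ≤ (c₁ + 1) L`.
  have hL : 1 ≤ Real.log (6 * n / ε) := by
    rw [Real.le_log_iff_exp_le (by positivity), le_div_iff₀ hε]
    nlinarith [Real.exp_one_lt_d9, Real.exp_pos 1]
  set L := Real.log (6 * n / ε)
  refine ⟨Nat.one_le_ceil_iff.2 (by positivity), ?_⟩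
  have h1 : (taylorDegree c₁ n ε : ℝ) ≤ (c₁ + 1) * L := by
    have := (Nat.ceil_lt_add_one (a := c₁ * L) (by positivity)).le
    change (taylorDegree c₁ n ε : ℝ) ≤ _ at this
    linarith
  have h2 : c₀ * k * L ≤ blockLength c₀ k n ε := Nat.le_ceil _
  have h3 : (c₁ + 1) / c₀ ≤ (⌈(c₁ + 1) / c₀⌉₊ : ℝ) := Nat.le_ceil _
  have h4 : (taylorDegree c₁ n ε : ℝ) * k ≤ ⌈(c₁ + 1) / c₀⌉₊ * blockLength c₀ k n ε :=
    calc (taylorDegree c₁ n ε : ℝ) * k ≤ (c₁ + 1) * L * k := by gcongr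
      _ = (c₁ + 1) / c₀ * (c₀ * k * L) := by field_simp
      _ ≤ _ := by gcongr
  exact_mod_cast h4

/-- For `m ≤ q` one has `r = m` and `B = Pq`; for `m ≥ q` both `r` and `B / P` are of order `√(mq)`.
So `r`, `q` and `B` are all bounded by multiples of `Z`, and the remaining logarithms by multiples
of `Λ`. -/
theorem log_rank_bound_le {d k m q r B P : ℕ} (hd : 1 ≤ d) (hmq : 2 ≤ m * q)
    (hr : r = min m (Nat.sqrt (m * q))) (hB : B = P * (m * q) / r) :
    Real.log ((r * (d ^ (2 * (r * k)) * ((B + 1) * (((B + 1) ^ 3 * ((B + 1) * (m + 1)) ^ P) ^ q *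
      (d ^ (2 * k) * (m + 1)) ^ B))) : ℕ) : ℝ) ≤
    (1 + 4 * k * Real.log d + 4 * (2 * Real.log (P + 1) + 1) +
      P * (2 * Real.log (P + 1) + 3) + 3 * P * (4 * k * Real.log d + 2)) *
      max (q : ℝ) (Real.sqrt (m * q)) * Real.log (m * q) := by
  have hm : 1 ≤ m := Nat.pos_of_ne_zero fun h => by simp [h] at hmq
  have hq : 1 ≤ q := Nat.pos_of_ne_zero fun h => by simp [h] at hmq
  have hs : 1 ≤ Nat.sqrt (m * q) := Nat.sqrt_pos.2 (by omega)
  have hr1 : 1 ≤ r := by omega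
  set Z := max (q : ℝ) (Real.sqrt (m * q))
  set Λ := Real.log (m * q)
  set a := 2 * Real.log (P + 1) + 1 with ha
  have hqZ : (q : ℝ) ≤ Z := le_max_left _ _
  have hZ1 : 1 ≤ Z := le_trans (by exact_mod_cast hq) hqZ
  have hsZ : (Nat.sqrt (m * q) : ℝ) ≤ Z := by
    refine le_trans ?_ (le_max_right _ _)
    have := Real.nat_sqrt_le_real_sqrt (a := m * q)
    push_cast at this
    exact this
  have hrZ : (r : ℝ) ≤ Z := le_trans (by exact_mod_cast (hr ▸ min_le_right _ _)) hsZ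
  have hBZ : (B : ℝ) ≤ 3 * P * Z := by
    rcases le_total m q with hmq' | hmq'
    · have h1 : m ≤ Nat.sqrt (m * q) := Nat.le_sqrt.2 (Nat.mul_le_mul_left m hmq')
      have h2 : B = P * q := by
        rw [hB, hr, min_eq_left h1, mul_left_comm, Nat.mul_div_cancel_left _ hm]
      rw [h2]
      push_cast
      nlinarith [(Nat.cast_nonneg P : (0 : ℝ) ≤ P)]
    · have h1 : Nat.sqrt (m * q) ≤ m := by
        rw [← Nat.sqrt_eq m]
        exact Nat.sqrt_le_sqrt (by rw [Nat.sqrt_eq]; exact Nat.mul_le_mul_left m hmq')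
      have h2 : B ≤ 3 * P * Nat.sqrt (m * q) := by
        rw [hB, hr, min_eq_right h1]
        refine Nat.div_le_of_le_mul ?_
        -- With `s = ⌊√(mq)⌋ ≥ 1`, `mq ≤ s² + 2s ≤ 3s²`.
        have h3 : m * q ≤ 3 * (Nat.sqrt (m * q) * Nat.sqrt (m * q)) := by
          have := Nat.sqrt_le_add (m * q)
          nlinarith
        calc P * (m * q) ≤ P * (3 * (Nat.sqrt (m * q) * Nat.sqrt (m * q))) :=
              Nat.mul_le_mul_left _ h3
          _ = _ := by ring
      calc (B : ℝ) ≤ 3 * P * Nat.sqrt (m * q) := by exact_mod_cast h2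
        _ ≤ _ := by gcongr
  have hx2 : (2 : ℝ) ≤ m * q := by exact_mod_cast hmq
  have hΛ2 : Real.log 2 ≤ Λ := Real.log_le_log (by norm_num) hx2
  -- As `log 2 > 1/2`, terms without a logarithm of `mq` are absorbed at the price of a factor 2.
  have hΛ1 : 1 ≤ 2 * Λ := by linarith [Real.log_two_gt_d9]
  have hd0 : 0 ≤ Real.log d := Real.log_natCast_nonneg d
  have hP0 : 0 ≤ Real.log (P + 1 : ℝ) :=
    Real.log_nonneg (by linarith [(Nat.cast_nonneg P : (0 : ℝ) ≤ P)])
  have hlogr : Real.log r ≤ Λ := by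
    refine Real.log_le_log (by exact_mod_cast hr1) ?_
    have h : r ≤ m * q := (hr ▸ min_le_left _ _ : r ≤ m).trans (Nat.le_mul_of_pos_right m hq)
    exact_mod_cast h
  have hlogm : Real.log (m + 1) ≤ 2 * Λ := by
    have h : m + 1 ≤ 2 * (m * q) := by nlinarith
    have h' : Real.log (m + 1) ≤ Real.log (2 * (m * q)) :=
      Real.log_le_log (by positivity) (by exact_mod_cast h)
    rw [Real.log_mul (by norm_num) (by linarith)] at h'
    linarith
  have hlogB : Real.log (B + 1) ≤ a * Λ := by
    have h : B + 1 ≤ (P + 1) * (m * q) := by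
      have : B ≤ P * (m * q) := hB ▸ Nat.div_le_self _ _
      nlinarith
    have h' : Real.log (B + 1) ≤ Real.log ((P + 1) * (m * q)) :=
      Real.log_le_log (by positivity) (by exact_mod_cast h)
    rw [Real.log_mul (by positivity) (by linarith)] at h'
    nlinarith
  have hlogm0 : 0 ≤ Real.log (m + 1 : ℝ) :=
    Real.log_nonneg (by linarith [(Nat.cast_nonneg m : (0 : ℝ) ≤ m)])
  have hlogd : Real.log d ≤ 2 * Real.log d * Λ := by nlinarith
  have hd' : (d : ℝ) ≠ 0 := by exact_mod_cast (by omega : d ≠ 0)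
  have hr' : (r : ℝ) ≠ 0 := by exact_mod_cast (by omega : r ≠ 0)
  have hB' : (B + 1 : ℝ) ≠ 0 := by positivity
  have hm' : (m + 1 : ℝ) ≠ 0 := by positivity
  have hlog : Real.log ((r * (d ^ (2 * (r * k)) * ((B + 1) * (((B + 1) ^ 3 *
      ((B + 1) * (m + 1)) ^ P) ^ q * (d ^ (2 * k) * (m + 1)) ^ B))) : ℕ) : ℝ) =
      Real.log r + (2 * (r * k) * Real.log d + (Real.log (B + 1) + (q * (3 * Real.log (B + 1) +
        P * (Real.log (B + 1) + Real.log (m + 1))) + B * (2 * k * Real.log d +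
          Real.log (m + 1))))) := by
    push_cast
    rw [Real.log_mul hr' (by positivity), Real.log_mul (by positivity) (by positivity),
      Real.log_mul hB' (by positivity), Real.log_mul (by positivity) (by positivity),
      Real.log_pow, Real.log_pow, Real.log_mul (by positivity) (by positivity), Real.log_pow,
      Real.log_pow, Real.log_mul hB' hm', Real.log_pow, Real.log_mul (by positivity) hm',
      Real.log_pow]
    push_cast
    ring
  rw [hlog]
  have hΛ0 : 0 ≤ Λ := by linarith
  have ha0 : 0 ≤ a := by positivity
  have hZΛ : Λ ≤ Z * Λ := le_mul_of_one_le_left hΛ0 hZ1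
  have e1 : 2 * (r * k) * Real.log d ≤ 4 * k * Real.log d * (Z * Λ) :=
    calc 2 * (r * k) * Real.log d ≤ 2 * (Z * k) * (2 * Real.log d * Λ) := by gcongr
      _ = _ := by ring
  have e2 : Real.log (B + 1) ≤ a * (Z * Λ) := hlogB.trans (by gcongr)
  have e3 : q * (3 * Real.log (B + 1) + P * (Real.log (B + 1) + Real.log (m + 1))) ≤
      (3 * a + P * (a + 2)) * (Z * Λ) :=
    calc q * (3 * Real.log (B + 1) + P * (Real.log (B + 1) + Real.log (m + 1)))
        ≤ q * (3 * (a * Λ) + P * (a * Λ + 2 * Λ)) := by gcongr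
      _ ≤ Z * (3 * (a * Λ) + P * (a * Λ + 2 * Λ)) := by gcongr
      _ = _ := by ring
  have e4 : B * (2 * k * Real.log d + Real.log (m + 1)) ≤
      3 * P * (4 * k * Real.log d + 2) * (Z * Λ) :=
    calc B * (2 * k * Real.log d + Real.log (m + 1))
        ≤ (3 * P * Z) * (2 * k * (2 * Real.log d * Λ) + 2 * Λ) := by gcongr
      _ = _ := by ring
  have e5 : 2 * Real.log (P + 1 : ℝ) + 3 = a + 2 := by rw [ha]; ring
  rw [e5]
  linarith

end Estimates

end SpinChain

/-! ### The main theorem -/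

theorem lemma5 (d k : ℕ) (hd : 1 ≤ d) (hk : 1 ≤ k) (c₀ c₁ : ℝ) (hc₀ : 0 < c₀) (hc₁ : 0 < c₁) :
    ∃ C : ℝ, 0 < C ∧
      ∀ (n : ℕ) (g β ε : ℝ) (H : SpinChain.LocalHamiltonian n d k g),
        0 ≤ β → 8 * g * k * β ≤ 1 → 0 < ε → ε ≤ 1 →
        ∀ ℓ₀ m : ℕ, ℓ₀ = SpinChain.blockLength c₀ k n ε → m = SpinChain.taylorDegree c₁ n ε →
        ∀ q : ℕ, m * q ≠ 1 →
        ∀ i : Fin n,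
          Real.log (SpinChain.schmidtRank (SpinChain.gibbsMPO H β ℓ₀ m ^ q) i) ≤
            C * max (q : ℝ) (Real.sqrt (m * q)) * Real.log (m * q) := by
  set K := ⌈(c₁ + 1) / c₀⌉₊ with hK
  set P := 6 * K + 6 with hP
  have hd0 : 0 ≤ Real.log d := Real.log_natCast_nonneg d
  have hP0 : 0 ≤ Real.log (P + 1 : ℝ) :=
    Real.log_nonneg (by linarith [(Nat.cast_nonneg P : (0 : ℝ) ≤ P)])
  refine ⟨1 + 4 * k * Real.log d + 4 * (2 * Real.log (P + 1) + 1) +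
      P * (2 * Real.log (P + 1) + 3) + 3 * P * (4 * k * Real.log d + 2), by positivity, ?_⟩
  intro n g β ε H _ _ hε hε1 ℓ m hℓ hm q hmq i
  obtain ⟨hm1, hmK⟩ := SpinChain.taylorDegree_mul_le hc₀ hc₁ k i.pos hε hε1
  rw [← hm] at hm1
  rw [← hm, ← hℓ, ← hK] at hmK
  rcases Nat.eq_zero_or_pos q with rfl | hq
  -- For `q = 0` the right side vanishes, and the identity has Schmidt rank at most 1.
  · rw [pow_zero]
    have h : (SpinChain.schmidtRank (1 : SpinChain.Operator n d) i : ℝ) ≤ 1 := by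
      exact_mod_cast SpinChain.schmidtRank_one_le i
    simpa using Real.log_nonpos (Nat.cast_nonneg _) h
  have hmq2 : 2 ≤ m * q := by
    have := Nat.mul_pos hm1 hq
    omega
  -- `r ≤ m` keeps the strip within `K` block lengths; `r ≤ √(mq)` balances the cost `r` of moving
  -- the cut against the crossing number `B ≈ Pmq / r`.
  set r := min m (Nat.sqrt (m * q)) with hr
  have hr1 : 1 ≤ r := le_min hm1 (Nat.sqrt_pos.2 (by omega))
  have hle := SpinChain.schmidtRank_gibbsMPO_pow_le hd hk H β ℓ m q r (P * (m * q) / r) K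
    (le_trans (Nat.le_mul_of_pos_left k hm1) hmK)
    (le_trans (Nat.mul_le_mul_right k (min_le_left _ _)) hmK)
    (by
      rw [show q * ((6 * K + 6) * m) = P * (m * q) by rw [hP]; ring]
      exact Nat.lt_mul_div_succ _ hr1) i
  refine le_trans ?_ (SpinChain.log_rank_bound_le hd hmq2 hr rfl)
  rcases Nat.eq_zero_or_pos (SpinChain.schmidtRank (SpinChain.gibbsMPO H β ℓ m ^ q) i)
    with h0 | h0
  · rw [h0, Nat.cast_zero, Real.log_zero]
    exact Real.log_natCast_nonneg _
  · exact Real.log_le_log (by exact_mod_cast h0) (by exact_mod_cast hle)
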